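/- **Setting.** Consider a static team of $N$ agents. The state space $\mathcal X$ and the observation spaces $\mathcal Y^1,\dots,\mathcal Y^N$ are complete separable metric spaces. The action spaces $\mathcal U^1,\dots,\mathcal U^N$ are compact subsets of Polish spaces. The state $X$ and the observations $Y^{1:N}=(Y^1,\dots,Y^N)$ have a joint law $P$, a Borel probability measure on $\mathcal X\times\mathcal Y^1\times\dots\times\mathcal Y^N$. The cost is a function $c:\mathcal X\times\mathcal Y^{1:N}\times\mathcal U^{1:N}\to[0,\infty)$. A behavioral strategy of agent $i$ is a Markov kernel $\pi^i(du^i\mid y^i)$ from $\mathcal Y^i$ to $\mathcal U^i$; a deterministic strategy is a Borel map $\gamma^i:\mathcal Y^i\to\mathcal U^i$, identified with the kernel $\delta_{\gamma^i(y^i)}(du^i)$. The expected cost of a behavioral strategy profile is $$J(\pi^{1:N})=\int\!\!\int c(x,y^{1:N},u^{1:N})\prod_{i=1}^N\pi^i(du^i\mid y^i)\,P(dx,dy^{1:N})\in[0,\infty].$$ **Condition C1.** Let $\mathcal A$ be a metric space with metric $d$, let $\eta:\mathcal A\times\mathcal B\to\mathbb R$, and let $\nu$ be a non-negative measure on $\mathcal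 B$. The pair $(\eta,\nu)$ satisfies C1 if $\eta$ is continuous and there is a bounded measurable $h:\mathcal A\times\mathcal B\to[0,\infty)$ with $\sup_{a\in\mathcal A}\int h(a,b)\,\nu(db)<\infty$ such that for every $\epsilon>0$ there is $\delta>0$ such that for all $a_0,a\in\mathcal A$ with $d(a,a_0)<\delta$ and all $b\in\mathcal B$, $|\eta(a,b)-\eta(a_0,b)|<\epsilon\,h(a_0,b)$. Below, $\Pr(\cdot\mid\cdot)$ denotes regular conditional laws under $P$, and identities between them hold for almost every value of the conditioning variable. Product spaces carry the maximum metric. **Conditional-independence assumption.** The spaces $\mathcal X,\mathcal Y^i,\mathcal U^i$ are $\sigma$-compact for all $i$, and there are non-negative measures $\nu_{\mathcal X}$ on $\mathcal X$ and $\nu_{\mathcal Y^i}$ on $\mathcal Y^i$ and bounded continuous functions $\eta^i,\rho^i$ ($1\le i\le N$) such that $$\Pr(dy^{1:N}\mid x)=\prod_{i=1}^N\Pr(dy^i\mid x),\qquad \Pr(dy^i\mid x)=\eta^i(x,y^i)\,\nu_{\mathcal Y^i}(dy^i),\qquad \Pr(dx\mid y^i)=\rho^i(y^i,x)\,\nu_{\mathcal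 X}(dx),$$ and all pairs $(\rho^i,\nu_{\mathcal X})$, $(\eta^i,\nu_{\mathcal Y^i})$ satisfy C1 (with respect to the conditioning variable). **Degraded-information assumption.** Here $N=2$. The spaces $\mathcal X,\mathcal Y^i,\mathcal U^i$ are $\sigma$-compact, and there are non-negative measures $\nu_{\mathcal X},\nu_{\mathcal Y^1},\nu_{\mathcal Y^2}$ on $\mathcal X,\mathcal Y^1,\mathcal Y^2$ and bounded continuous functions $\eta^1,\eta^2,\rho^1,\rho^2$ such that $$\Pr(dy^2,dy^1\mid x)=\Pr(dy^2\mid y^1)\Pr(dy^1\mid x),\qquad \Pr(dy^2\mid y^1)=\eta^2(y^1,y^2)\,\nu_{\mathcal Y^2}(dy^2),$$ $$\Pr(dy^1\mid x,y^2)=\eta^1(x,y^2,y^1)\,\nu_{\mathcal Y^1}(dy^1),\qquad \Pr(dy^1,dx\mid y^2)=\rho^2(y^2,y^1,x)\,\nu_{\mathcal Y^1}(dy^1)\nu_{\mathcal X}(dx),$$ $$\Pr(dx\mid y^1)=\rho^1(y^1,x)\,\nu_{\mathcal X}(dx),$$ and the pairs $(\rho^1,\nu_{\mathcal X})$, $(\rho^2,\nu_{\mathcal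 Y^1}\times\nu_{\mathcal X})$, $(\eta^1,\nu_{\mathcal Y^1})$, $(\eta^2,\nu_{\mathcal Y^2})$ satisfy C1 (with respect to the conditioning variables). **Statement.** Suppose that $c$ is continuous and that some profile of behavioral strategies $\tilde\pi^{1:N}$ has $J(\tilde\pi^{1:N})<\infty$. If the conditional-independence assumption holds, or if $N=2$ and the degraded-information assumption holds (for one of the two orderings of the agents), then the team has an optimal solution in deterministic strategies: there is a profile of deterministic strategies $\gamma^{1:N}$ with $$J(\gamma^{1:N})=\inf_{\pi^{1:N}}J(\pi^{1:N}),$$ where the infimum is over all profiles of behavioral strategies. -/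

import Mathlib

open MeasureTheory ProbabilityTheory
open scoped ENNReal NNReal

noncomputable section

/-- An `N`-agent static team with state space `X`, observation spaces `Y i` and action spaces `U i`:
the joint law of the state and the observations, and a non-negative cost function. -/
structure StaticTeam (N : ℕ) (X : Type*) (Y U : Fin N → Type*)
    [MeasurableSpace X] [∀ i, MeasurableSpace (Y i)] where
  /-- joint law of the state and of all the observations -/
  law : Measure (X × (∀ i, Y i))
  /-- the joint law is a probability measure -/
  isProbabilityMeasure_law : IsProbabilityMeasure law
  /-- cost as a function of state, observations and actions -/
  cost : X × (∀ i, Y i) × (∀ i, U i) → ℝ≥0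

/-- Condition C1 for a function `η : A × Y → ℝ` and a non-negative measure `ν` on `Y`. The
function `h` is the variation control function. (The strict inequality at `a = a₀` forces `h > 0`,
hence `ν` is automatically `σ`-finite when `A` is non-empty.) -/
def ConditionC1 {A Y : Type*} [MetricSpace A] [MeasurableSpace A]
    [TopologicalSpace Y] [MeasurableSpace Y] (η : A × Y → ℝ) (ν : Measure Y) : Prop :=
  Continuous η ∧
  ∃ h : A × Y → ℝ, Measurable h ∧ (∀ p, 0 ≤ h p) ∧ (∃ C : ℝ, ∀ p, h p ≤ C) ∧
    (⨆ a : A, ∫⁻ y, ENNReal.ofReal (h (a, y)) ∂ν) < ∞ ∧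
    ∀ ε : ℝ, 0 < ε → ∃ δ : ℝ, 0 < δ ∧ ∀ a₀ a : A, dist a a₀ < δ →
      ∀ y : Y, |η (a, y) - η (a₀, y)| < ε * h (a₀, y)

/-- `HasCondDensity P f g φ ν`: under `P`, the conditional law of the random variable `g` given
the random variable `f` is `φ (a, b) ν(db)` at almost every value `a` of `f`. -/
def HasCondDensity {Ω A B : Type*} [MeasurableSpace Ω] [MeasurableSpace A] [MeasurableSpace B]
    [StandardBorelSpace B] [Nonempty B] (P : Measure Ω) [IsFiniteMeasure P]
    (f : Ω → A) (g : Ω → B) (φ : A × B → ℝ) (ν : Measure B) : Prop :=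
  ∀ᵐ a ∂(P.map f), condDistrib g f P a = ν.withDensity (fun b => ENNReal.ofReal (φ (a, b)))

namespace StaticTeam

section Strategies

variable {N : ℕ} {X : Type*} {Y U : Fin N → Type*}
  [MeasurableSpace X] [∀ i, MeasurableSpace (Y i)] [∀ i, MeasurableSpace (U i)]

instance (T : StaticTeam N X Y U) : IsProbabilityMeasure T.law := T.isProbabilityMeasure_law

/-- The state, as a random variable. -/
def state (ω : X × (∀ i, Y i)) : X := ω.1

/-- The vector of all observations, as a random variable. -/
def allObs (ω : X × (∀ i, Y i)) : ∀ i, Y i := ω.2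

/-- The observation of agent `i`, as a random variable. -/
def obs (i : Fin N) (ω : X × (∀ i, Y i)) : Y i := ω.2 i

/-- A profile of behavioral strategies: a Markov kernel from `Y i` to `U i` for every agent. -/
def BehavioralProfile (_ : StaticTeam N X Y U) : Type _ :=
  ∀ i, {κ : Kernel (Y i) (U i) // IsMarkovKernel κ}

/-- A profile of deterministic strategies: a measurable map from `Y i` to `U i` for every agent. -/
def DeterministicProfile (_ : StaticTeam N X Y U) : Type _ :=
  ∀ i, {γ : Y i → U i // Measurable γ}

/-- The behavioral strategies `δ_{γ i (y)}(du)` induced by deterministic strategies `γ i`. -/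
def DeterministicProfile.toBehavioral {T : StaticTeam N X Y U} (γ : T.DeterministicProfile) :
    T.BehavioralProfile :=
  fun i => ⟨Kernel.deterministic (γ i).1 (γ i).2, inferInstance⟩

instance {T : StaticTeam N X Y U} (π : T.BehavioralProfile) (i : Fin N) :
    IsMarkovKernel (π i).1 := (π i).2

/-- The expected cost of a profile of behavioral strategies: given the observations, the actions
are drawn independently, that of agent `i` from `π i (· | y i)`. -/
def expectedCost (T : StaticTeam N X Y U) (π : T.BehavioralProfile) : ℝ≥0∞ :=
  ∫⁻ ω, (∫⁻ u, (T.cost (ω.1, ω.2, u) : ℝ≥0∞) ∂(Measure.pi fun i => (π i).1 (ω.2 i))) ∂T.law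

/-- Some profile of behavioral strategies has finite expected cost. -/
def HasFiniteCostProfile (T : StaticTeam N X Y U) : Prop :=
  ∃ π : T.BehavioralProfile, T.expectedCost π < ∞

/-- The profile `π` attains the infimum of the expected cost over all behavioral strategies. -/
def IsOptimal (T : StaticTeam N X Y U) (π : T.BehavioralProfile) : Prop :=
  T.expectedCost π = ⨅ π' : T.BehavioralProfile, T.expectedCost π'

end Strategies

section Assumptions

variable {N : ℕ} {X : Type*} {Y U : Fin N → Type*}
  [MetricSpace X] [CompleteSpace X] [SecondCountableTopology X]
  [MeasurableSpace X] [BorelSpace X] [Nonempty X]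
  [∀ i, MetricSpace (Y i)] [∀ i, CompleteSpace (Y i)] [∀ i, SecondCountableTopology (Y i)]
  [∀ i, MeasurableSpace (Y i)] [∀ i, BorelSpace (Y i)] [∀ i, Nonempty (Y i)]
  [∀ i, TopologicalSpace (U i)]

/-- The conditional-independence assumption: the observations are conditionally independent given
the state, and the conditional laws of `Y i` given the state and of the state given `Y i` have
bounded continuous densities that satisfy condition C1. -/
def CondIndepObs (T : StaticTeam N X Y U) : Prop :=
  SigmaCompactSpace X ∧ (∀ i, SigmaCompactSpace (Y i)) ∧ (∀ i, SigmaCompactSpace (U i)) ∧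
  ∃ (νX : Measure X) (νY : ∀ i, Measure (Y i))
    (η : ∀ i, X × Y i → ℝ) (ρ : ∀ i, Y i × X → ℝ),
    (∀ i, Continuous (η i) ∧ ∃ C, ∀ p, |η i p| ≤ C) ∧
    (∀ i, Continuous (ρ i) ∧ ∃ C, ∀ p, |ρ i p| ≤ C) ∧
    (∀ᵐ x ∂(T.law.map state), condDistrib allObs state T.law x =
      Measure.pi fun i => condDistrib (obs i) state T.law x) ∧
    (∀ i, HasCondDensity T.law state (obs i) (η i) (νY i)) ∧
    (∀ i, HasCondDensity T.law (obs i) state (ρ i) νX) ∧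
    (∀ i, ConditionC1 (ρ i) νX) ∧
    (∀ i, ConditionC1 (η i) (νY i))

/-- The degraded-information assumption: there are exactly two agents, `i₁` and `i₂`, and the
observation of `i₂` is a degraded version of that of `i₁`. -/
def DegradedObs (T : StaticTeam N X Y U) : Prop :=
  SigmaCompactSpace X ∧ (∀ i, SigmaCompactSpace (Y i)) ∧ (∀ i, SigmaCompactSpace (U i)) ∧
  ∃ i₁ i₂ : Fin N, i₁ ≠ i₂ ∧ (∀ j, j = i₁ ∨ j = i₂) ∧
  ∃ (νX : Measure X) (ν₁ : Measure (Y i₁)) (ν₂ : Measure (Y i₂))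
    (η₁ : (X × Y i₂) × Y i₁ → ℝ) (η₂ : Y i₁ × Y i₂ → ℝ)
    (ρ₁ : Y i₁ × X → ℝ) (ρ₂ : Y i₂ × (Y i₁ × X) → ℝ),
    (Continuous η₁ ∧ ∃ C, ∀ p, |η₁ p| ≤ C) ∧
    (Continuous η₂ ∧ ∃ C, ∀ p, |η₂ p| ≤ C) ∧
    (Continuous ρ₁ ∧ ∃ C, ∀ p, |ρ₁ p| ≤ C) ∧
    (Continuous ρ₂ ∧ ∃ C, ∀ p, |ρ₂ p| ≤ C) ∧
    (∀ᵐ x ∂(T.law.map state), condDistrib (fun ω => (obs i₁ ω, obs i₂ ω)) state T.law x =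
      (condDistrib (obs i₁) state T.law x).compProd (condDistrib (obs i₂) (obs i₁) T.law)) ∧
    HasCondDensity T.law (obs i₁) (obs i₂) η₂ ν₂ ∧
    HasCondDensity T.law (fun ω => (state ω, obs i₂ ω)) (obs i₁) η₁ ν₁ ∧
    HasCondDensity T.law (obs i₂) (fun ω => (obs i₁ ω, state ω)) ρ₂ (ν₁.prod νX) ∧
    HasCondDensity T.law (obs i₁) state ρ₁ νX ∧
    ConditionC1 ρ₁ νX ∧ ConditionC1 ρ₂ (ν₁.prod νX) ∧
    ConditionC1 η₁ ν₁ ∧ ConditionC1 η₂ ν₂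

end Assumptions

end StaticTeam

end

/-! Both information assumptions serve only to show that the joint law is absolutely continuous with
respect to a product `μX × ∏ μ i` of probability measures. With the density `g` moved into the cost,
this is Witsenhausen's change of measure: the expected cost of a profile becomes the integral of `g
* c` against `μX × ∏ Q i`, where `Q i` is the joint law of observation and action of agent `i` when
the observation has law `μ i`.

Since `U i` is compact, the possible `Q i` form a weakly compact set by Prokhorov's theorem, and
product measures depend continuously on their factors. The obstacle is that `g` is merely
integrable. But all competing laws have the same marginal on states and observations, so
approximating `g` in L¹ by bounded continuous functions is uniform over profiles. Truncating the
cost then gives lower semicontinuity, hence a minimizing `Q`. Disintegrating `Q` yields behavioral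
strategies; realising these by independent random seeds and fixing a good seed makes them
deterministic. -/

noncomputable section

/-! ### Product measures and product kernels -/

section ProductMeasures

variable {ι : Type*} [Fintype ι]

lemma indicator_univ_pi_prod {Y : ι → Type*} (s : ∀ i, Set (Y i)) (f : ∀ i, Y i → ℝ≥0∞)
    (y : ∀ i, Y i) :
    (Set.univ.pi s).indicator (fun y => ∏ i, f i (y i)) y = ∏ i, (s i).indicator (f i) (y i) := by
  by_cases hy : y ∈ Set.univ.pi s
  · rw [Set.indicator_of_mem hy]
    exact Finset.prod_congr rfl fun i _ => (Set.indicator_of_mem (hy i trivial) _).symm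
  · rw [Set.indicator_of_notMem hy]
    simp only [Set.mem_univ_pi, not_forall] at hy
    obtain ⟨i, hi⟩ := hy
    exact (Finset.prod_eq_zero (Finset.mem_univ i) (Set.indicator_of_notMem hi _)).symm

lemma pi_dirac {Y : ι → Type*} [∀ i, MeasurableSpace (Y i)] (y : ∀ i, Y i) :
    (Measure.pi fun i => Measure.dirac (y i)) = Measure.dirac y := by
  refine Measure.pi_eq fun s hs => ?_
  rw [Measure.dirac_apply' _ (MeasurableSet.univ_pi hs),
    Finset.prod_congr rfl fun i _ => Measure.dirac_apply' _ (hs i), ← indicator_univ_pi_prod]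
  simp [Pi.one_def]

lemma lintegral_pi_prod_eq {Y : ι → Type*} [∀ i, MeasurableSpace (Y i)]
    (μ : ∀ i, Measure (Y i)) [∀ i, IsProbabilityMeasure (μ i)]
    {f : ∀ i, Y i → ℝ≥0∞} (hf : ∀ i, Measurable (f i)) :
    ∫⁻ y, ∏ i, f i (y i) ∂Measure.pi μ = ∏ i, ∫⁻ a, f i a ∂μ i := by
  refine (lintegral_prod_eq_prod_lintegral_of_indepFun Finset.univ
    (fun i (y : ∀ i, Y i) => f i (y i))
    (iIndepFun_pi fun i => (hf i).aemeasurable)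
    fun i => (hf i).comp (measurable_pi_apply i)).trans ?_
  exact Finset.prod_congr rfl fun i _ =>
    (measurePreserving_eval μ i).lintegral_comp (hf i)

/-- The product of the Radon–Nikodym derivatives is a density, because its integral over a box
factors. -/
lemma pi_absolutelyContinuous {Y : ι → Type*} [∀ i, MeasurableSpace (Y i)]
    {m n : ∀ i, Measure (Y i)} [∀ i, IsProbabilityMeasure (m i)] [∀ i, IsProbabilityMeasure (n i)]
    (h : ∀ i, m i ≪ n i) : Measure.pi m ≪ Measure.pi n := by
  have hd : ∀ i, (n i).withDensity ((m i).rnDeriv (n i)) = m i :=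
    fun i => Measure.withDensity_rnDeriv_eq _ _ (h i)
  have : Measure.pi m =
      (Measure.pi n).withDensity (fun y => ∏ i, (m i).rnDeriv (n i) (y i)) := by
    refine Measure.pi_eq fun s hs => ?_
    rw [withDensity_apply _ (MeasurableSet.univ_pi hs),
      ← lintegral_indicator (MeasurableSet.univ_pi hs)]
    simp_rw [indicator_univ_pi_prod]
    rw [lintegral_pi_prod_eq n fun i => (Measure.measurable_rnDeriv _ _).indicator (hs i)]
    refine Finset.prod_congr rfl fun i _ => ?_
    rw [lintegral_indicator (hs i), ← withDensity_apply _ (hs i), hd]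
  rw [this]
  exact withDensity_absolutelyContinuous _ _

variable {Y U : ι → Type*} [∀ i, MeasurableSpace (Y i)] [∀ i, MeasurableSpace (U i)]

/-- The kernel `y ↦ ⨂ᵢ κ i (y i)`. -/
def piKernel (κ : ∀ i, Kernel (Y i) (U i)) [∀ i, IsMarkovKernel (κ i)] :
    Kernel (∀ i, Y i) (∀ i, U i) where
  toFun y := Measure.pi fun i => κ i (y i)
  measurable' := by
    refine Measurable.measure_of_isPiSystem_of_isProbabilityMeasure generateFrom_pi.symm
      isPiSystem_pi ?_
    rintro _ ⟨s, hs, rfl⟩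
    simp only [Measure.pi_pi]
    exact Finset.measurable_prod _ fun i _ =>
      ((κ i).measurable_coe (hs i trivial)).comp (measurable_pi_apply i)

lemma piKernel_apply (κ : ∀ i, Kernel (Y i) (U i)) [∀ i, IsMarkovKernel (κ i)] (y : ∀ i, Y i) :
    piKernel κ y = Measure.pi fun i => κ i (y i) := rfl

instance (κ : ∀ i, Kernel (Y i) (U i)) [∀ i, IsMarkovKernel (κ i)] :
    IsMarkovKernel (piKernel κ) :=
  ⟨fun y => by rw [piKernel_apply]; infer_instance⟩

/-- Drawing all observations and then all actions amounts to drawing independent observation-action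
pairs; boxes suffice to see this. -/
lemma pi_compProd (μ : ∀ i, Measure (Y i)) [∀ i, IsProbabilityMeasure (μ i)]
    (κ : ∀ i, Kernel (Y i) (U i)) [∀ i, IsMarkovKernel (κ i)] :
    Measure.pi (fun i => μ i ⊗ₘ κ i) =
      ((Measure.pi μ) ⊗ₘ piKernel κ).map (fun p i => (p.1 i, p.2 i)) := by
  have hm : Measurable (fun (p : (∀ i, Y i) × (∀ i, U i)) i => (p.1 i, p.2 i)) := by fun_prop
  refine Measure.pi_eq fun s hs => ?_
  rw [Measure.map_apply hm (MeasurableSet.univ_pi hs),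
    Measure.compProd_apply (hm (MeasurableSet.univ_pi hs))]
  have : ∀ y : ∀ i, Y i, piKernel κ y (Prod.mk y ⁻¹'
      ((fun (p : (∀ i, Y i) × (∀ i, U i)) i => (p.1 i, p.2 i)) ⁻¹' Set.univ.pi s)) =
      ∏ i, κ i (y i) (Prod.mk (y i) ⁻¹' s i) := by
    intro y
    rw [piKernel_apply, ← Measure.pi_pi]
    congr 1
  simp_rw [this]
  rw [lintegral_pi_prod_eq μ fun i => Kernel.measurable_kernel_prodMk_left (hs i)]
  exact Finset.prod_congr rfl fun i _ => (Measure.compProd_apply (hs i)).symm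

lemma lintegral_pi_compProd (μ : ∀ i, Measure (Y i)) [∀ i, IsProbabilityMeasure (μ i)]
    (κ : ∀ i, Kernel (Y i) (U i)) [∀ i, IsMarkovKernel (κ i)]
    {F : (∀ i, Y i × U i) → ℝ≥0∞} (hF : Measurable F) :
    ∫⁻ z, F z ∂Measure.pi (fun i => μ i ⊗ₘ κ i) =
      ∫⁻ y, ∫⁻ u, F (fun i => (y i, u i)) ∂(Measure.pi fun i => κ i (y i)) ∂Measure.pi μ := by
  have hm : Measurable (fun (p : (∀ i, Y i) × (∀ i, U i)) i => (p.1 i, p.2 i)) := by fun_prop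
  rw [pi_compProd, lintegral_map hF hm]
  exact Measure.lintegral_compProd (hF.comp hm)

end ProductMeasures

/-! ### Weak compactness of the strategy sets -/

section Marginal

variable {Y U : Type*} [TopologicalSpace Y] [PolishSpace Y] [MeasurableSpace Y] [BorelSpace Y]
  [TopologicalSpace U] [PolishSpace U] [CompactSpace U] [MeasurableSpace U] [BorelSpace U]

/-- Joint laws of an observation with law `μ` and an action. -/
def jointLaws (U : Type*) [MeasurableSpace U] (μ : ProbabilityMeasure Y) :
    Set (ProbabilityMeasure (Y × U)) :=
  {Q | Q.map measurable_fst.aemeasurable = μ}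

/-- Prokhorov's theorem: if a compact `K` carries most of `μ`, then `K ×ˢ univ` is compact and
carries as much of every `Q`. Fixing a marginal is a closed condition. -/
lemma isCompact_jointLaws (μ : ProbabilityMeasure Y) : IsCompact (jointLaws U μ) := by
  have hcl : IsClosed (jointLaws U μ) :=
    isClosed_singleton.preimage (ProbabilityMeasure.continuous_map continuous_fst)
  rw [← hcl.closure_eq]
  refine isCompact_closure_of_isTightMeasureSet ?_
  rw [isTightMeasureSet_iff_exists_isCompact_measure_compl_le]
  intro ε hε
  have ht : IsTightMeasureSet {(μ : Measure Y)} := by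
    let := TopologicalSpace.upgradeIsCompletelyMetrizable Y
    exact isTightMeasureSet_singleton
  obtain ⟨K, hK, h⟩ := isTightMeasureSet_iff_exists_isCompact_measure_compl_le.1 ht ε hε
  refine ⟨K ×ˢ Set.univ, hK.prod isCompact_univ, ?_⟩
  rintro _ ⟨Q, hQ, rfl⟩
  have hQ' : (Q : Measure (Y × U)).map Prod.fst = μ := by
    rw [← show Q.map measurable_fst.aemeasurable = μ from hQ]; rfl
  have := h _ rfl
  rw [← hQ', Measure.map_apply measurable_fst hK.measurableSet.compl] at this
  convert this using 2
  ext p; simp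

end Marginal

/-! ### Lower semicontinuity of the cost under independent laws -/

section Semicontinuity

set_option linter.unusedSectionVars false

variable {ι : Type*} [Fintype ι] {X : Type*} {Y U : ι → Type*}
  [TopologicalSpace X] [PolishSpace X] [MeasurableSpace X] [BorelSpace X]
  [∀ i, TopologicalSpace (Y i)] [∀ i, PolishSpace (Y i)]
  [∀ i, MeasurableSpace (Y i)] [∀ i, BorelSpace (Y i)]
  [∀ i, TopologicalSpace (U i)] [∀ i, PolishSpace (U i)]
  [∀ i, MeasurableSpace (U i)] [∀ i, BorelSpace (U i)]

/-- The law under which the state and the observation-action pairs are independent. -/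
def independentLaw (μX : ProbabilityMeasure X) (Q : ∀ i, ProbabilityMeasure (Y i × U i)) :
    ProbabilityMeasure (X × ∀ i, Y i × U i) :=
  μX.prod (ProbabilityMeasure.pi Q)

/-- Forget the actions. -/
def forgetActions (p : X × ∀ i, Y i × U i) : X × ∀ i, Y i :=
  (p.1, fun i => (p.2 i).1)

lemma measurable_forgetActions : Measurable (forgetActions (X := X) (Y := Y) (U := U)) := by
  unfold forgetActions; fun_prop

lemma continuous_forgetActions : Continuous (forgetActions (X := X) (Y := Y) (U := U)) := by
  unfold forgetActions; fun_prop

lemma continuous_independentLaw (μX : ProbabilityMeasure X) :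
    Continuous (independentLaw (Y := Y) (U := U) μX) :=
  ProbabilityMeasure.continuous_prod.comp
    (continuous_const.prodMk ProbabilityMeasure.continuous_pi)

/-- The right-hand side does not involve `Q`, which is what makes L¹ estimates on `g` uniform in
`Q`. -/
lemma map_forgetActions_independentLaw (μX : ProbabilityMeasure X)
    {μ : ∀ i, ProbabilityMeasure (Y i)} {Q : ∀ i, ProbabilityMeasure (Y i × U i)}
    (hQ : ∀ i, Q i ∈ jointLaws (U i) (μ i)) :
    (independentLaw μX Q : Measure (X × ∀ i, Y i × U i)).map forgetActions =
      (μX : Measure X).prod (Measure.pi fun i => (μ i : Measure (Y i))) := by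
  have hQ' : ∀ i, (Q i : Measure (Y i × U i)).map Prod.fst = μ i := fun i => by
    rw [← show (Q i).map measurable_fst.aemeasurable = μ i from hQ i]; rfl
  have h1 : (Measure.pi fun i => (Q i : Measure (Y i × U i))).map (fun z i => (z i).1) =
      Measure.pi fun i => (μ i : Measure (Y i)) := by
    simp_rw [← hQ']
    exact Measure.pi_map_pi fun i => measurable_fst.aemeasurable
  rw [← h1]
  have h2 := Measure.map_prod_map (μX : Measure X)
    (Measure.pi fun i => (Q i : Measure (Y i × U i))) measurable_id
    (show Measurable (fun (z : ∀ i, Y i × U i) i => (z i).1) by fun_prop)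
  rw [Measure.map_id] at h2
  rw [h2]
  rfl

/-- For bounded continuous `g` this is weak convergence; the general case is a uniform limit of such
functionals. -/
lemma continuousOn_integral_independentLaw (μX : ProbabilityMeasure X)
    (μ : ∀ i, ProbabilityMeasure (Y i)) {g : X × (∀ i, Y i) → ℝ}
    (hg : Integrable g ((μX : Measure X).prod (Measure.pi fun i => (μ i : Measure (Y i)))))
    (b : BoundedContinuousFunction (X × ∀ i, Y i × U i) ℝ) :
    ContinuousOn (fun Q => ∫ p, g (forgetActions p) * b p ∂(independentLaw μX Q : Measure (X × ∀ i, Y i × U i)))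
      (Set.univ.pi fun i => jointLaws (U i) (μ i)) := by
  refine continuousOn_of_uniform_approx_of_continuousOn fun u hu => ?_
  obtain ⟨ε, hε, hu⟩ := Metric.mem_uniformity_dist.1 hu
  -- The L¹ error in `g` gets multiplied by at most `‖b‖`; the added `1` covers `b = 0`.
  have hδ : 0 < ε / (2 * (‖b‖ + 1)) := by positivity
  obtain ⟨f, hf, hfi⟩ := hg.exists_boundedContinuous_integral_sub_le hδ
  refine ⟨fun Q => ∫ p, f (forgetActions p) * b p ∂(independentLaw μX Q : Measure (X × ∀ i, Y i × U i)),
    Continuous.continuousOn ?_, fun Q hQ => hu ?_⟩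
  · let F : BoundedContinuousFunction (X × ∀ i, Y i × U i) ℝ :=
      f.compContinuous ⟨forgetActions, continuous_forgetActions⟩ * b
    exact (ProbabilityMeasure.continuous_integral_boundedContinuousFunction F).comp
      (continuous_independentLaw μX)
  · have hmap := map_forgetActions_independentLaw μX fun i => hQ i trivial
    have hgi : Integrable (fun p => g (forgetActions p)) (independentLaw μX Q :
        Measure (X × ∀ i, Y i × U i)) := by
      rw [← hmap] at hg; exact hg.comp_measurable measurable_forgetActions
    have hfi' : Integrable (fun p => f (forgetActions p)) (independentLaw μX Q :
        Measure (X × ∀ i, Y i × U i)) := by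
      rw [← hmap] at hfi; exact hfi.comp_measurable measurable_forgetActions
    have hb : ∀ᵐ p ∂(independentLaw μX Q : Measure (X × ∀ i, Y i × U i)), ‖b p‖ ≤ ‖b‖ :=
      Filter.Eventually.of_forall b.norm_coe_le_norm
    have hbm := b.continuous.aestronglyMeasurable
      (μ := (independentLaw μX Q : Measure (X × ∀ i, Y i × U i)))
    have hgs : Integrable (fun x => ‖g x - f x‖)
      ((μX : Measure X).prod (Measure.pi fun i => (μ i : Measure (Y i)))) := (hg.sub hfi).norm
    rw [dist_eq_norm, ← integral_sub (hgi.mul_bdd hbm hb) (hfi'.mul_bdd hbm hb)]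
    calc _ ≤ ∫ p, ‖g (forgetActions p) - f (forgetActions p)‖ * ‖b‖ ∂(independentLaw μX Q : Measure (X × ∀ i, Y i × U i)) := by
          refine norm_integral_le_of_norm_le ((hgi.sub hfi').norm.mul_const _)
            (Filter.Eventually.of_forall fun p => ?_)
          rw [← sub_mul, norm_mul]
          gcongr
          exact b.norm_coe_le_norm p
      _ = (∫ x, ‖g x - f x‖ ∂((μX : Measure X).prod
            (Measure.pi fun i => (μ i : Measure (Y i))))) * ‖b‖ := by
          rw [integral_mul_const, ← hmap, integral_map measurable_forgetActions.aemeasurable]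
          rw [hmap]; exact hgs.aestronglyMeasurable
      _ ≤ ε / (2 * (‖b‖ + 1)) * ‖b‖ := by gcongr
      _ < ε := by
          rw [div_mul_eq_mul_div, div_lt_iff₀ (by positivity)]
          nlinarith [norm_nonneg b]

/-- By monotone convergence the functional is the supremum over `M` of those with cost `min c M`,
each continuous on the constraint set. -/
lemma lowerSemicontinuousOn_lintegral_independentLaw (μX : ProbabilityMeasure X)
    (μ : ∀ i, ProbabilityMeasure (Y i)) {g : X × (∀ i, Y i) → ℝ≥0}
    (hg : Integrable (fun x => (g x : ℝ))
      ((μX : Measure X).prod (Measure.pi fun i => (μ i : Measure (Y i)))))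
    (hgm : Measurable g) {c : (X × ∀ i, Y i × U i) → ℝ≥0} (hc : Continuous c) :
    LowerSemicontinuousOn
      (fun Q : ∀ i, ProbabilityMeasure (Y i × U i) => ∫⁻ p, (g (forgetActions p) : ℝ≥0∞) * c p
        ∂(independentLaw μX Q : Measure (X × ∀ i, Y i × U i)))
      (Set.univ.pi fun i => jointLaws (U i) (μ i)) := by
  have hsup : ∀ Q : ∀ i, ProbabilityMeasure (Y i × U i), ∫⁻ p, (g (forgetActions p) : ℝ≥0∞) * c p
        ∂(independentLaw μX Q : Measure (X × ∀ i, Y i × U i)) =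
      ⨆ M : ℕ, ∫⁻ p, (g (forgetActions p) : ℝ≥0∞) * (min (c p) M : ℝ≥0)
        ∂(independentLaw μX Q : Measure (X × ∀ i, Y i × U i)) := by
    intro Q
    have hmono : Monotone fun (M : ℕ) p => (g (forgetActions p) : ℝ≥0∞) * (min (c p) M : ℝ≥0) := by
      intro M M' h p
      dsimp only
      gcongr
    rw [← lintegral_iSup (fun M => ?_) hmono]
    · refine lintegral_congr fun p => ?_
      rw [← ENNReal.mul_iSup]
      congr 1
      refine le_antisymm ?_ (iSup_le fun M => ENNReal.coe_le_coe.2 (min_le_left _ _))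
      obtain ⟨M, hM⟩ := exists_nat_ge (c p)
      exact le_iSup_of_le M (ENNReal.coe_le_coe.2 (le_min le_rfl hM))
    · exact ((hgm.comp measurable_forgetActions).coe_nnreal_ennreal).mul
        (hc.measurable.min measurable_const).coe_nnreal_ennreal
  simp_rw [hsup]
  refine lowerSemicontinuousOn_iSup fun M => ContinuousOn.lowerSemicontinuousOn ?_
  let b : BoundedContinuousFunction (X × ∀ i, Y i × U i) ℝ :=
    BoundedContinuousFunction.ofNormedAddCommGroup (fun p => ((min (c p) M : ℝ≥0) : ℝ))
      (by fun_prop) M fun p => by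
        rw [Real.norm_of_nonneg (NNReal.coe_nonneg _)]
        exact_mod_cast min_le_right _ _
  refine (ENNReal.continuous_ofReal.comp_continuousOn
    (continuousOn_integral_independentLaw (U := U) μX μ hg b)).congr fun Q hQ => ?_
  have hmap := map_forgetActions_independentLaw μX fun i => hQ i trivial
  have hgi : Integrable (fun p => (g (forgetActions p) : ℝ)) (independentLaw μX Q :
      Measure (X × ∀ i, Y i × U i)) := by
    rw [← hmap] at hg; exact hg.comp_measurable measurable_forgetActions
  rw [Function.comp_apply, ofReal_integral_eq_lintegral_ofReal
    (hgi.mul_bdd b.continuous.aestronglyMeasurable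
      (Filter.Eventually.of_forall b.norm_coe_le_norm))
    (Filter.Eventually.of_forall fun p => mul_nonneg (NNReal.coe_nonneg _) (NNReal.coe_nonneg _))]
  refine lintegral_congr fun p => ?_
  rw [show b p = ((min (c p) M : ℝ≥0) : ℝ) from rfl, ← NNReal.coe_mul, ENNReal.ofReal_coe_nnreal,
    ENNReal.coe_mul]

lemma exists_isMinOn_lintegral_independentLaw [∀ i, CompactSpace (U i)] [∀ i, Nonempty (U i)]
    (μX : ProbabilityMeasure X)
    (μ : ∀ i, ProbabilityMeasure (Y i)) {g : X × (∀ i, Y i) → ℝ≥0}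
    (hg : Integrable (fun x => (g x : ℝ))
      ((μX : Measure X).prod (Measure.pi fun i => (μ i : Measure (Y i)))))
    (hgm : Measurable g) {c : (X × ∀ i, Y i × U i) → ℝ≥0} (hc : Continuous c) :
    ∃ Q ∈ Set.univ.pi fun i => jointLaws (U i) (μ i), IsMinOn
      (fun Q : ∀ i, ProbabilityMeasure (Y i × U i) => ∫⁻ p, (g (forgetActions p) : ℝ≥0∞) * c p
        ∂(independentLaw μX Q : Measure (X × ∀ i, Y i × U i)))
      (Set.univ.pi fun i => jointLaws (U i) (μ i)) Q := by
  refine (lowerSemicontinuousOn_lintegral_independentLaw μX μ hg hgm hc).exists_isMinOn ?_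
    (isCompact_univ_pi fun i => isCompact_jointLaws (μ i))
  -- Nonemptiness: each agent plays a fixed action whatever is observed.
  exact ⟨fun i => (μ i).prod (diracProba (Classical.arbitrary (U i))), fun i _ =>
    ProbabilityMeasure.map_fst_prod _ _⟩

end Semicontinuity

/-! ### Existence of an optimum under absolute continuity -/

namespace StaticTeam

section Existence

variable {N : ℕ} {X : Type*} {Y U : Fin N → Type*}
    [TopologicalSpace X] [PolishSpace X] [MeasurableSpace X] [BorelSpace X]
    [∀ i, TopologicalSpace (Y i)] [∀ i, PolishSpace (Y i)]
    [∀ i, MeasurableSpace (Y i)] [∀ i, BorelSpace (Y i)]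
    [∀ i, TopologicalSpace (U i)] [∀ i, PolishSpace (U i)]
    [∀ i, MeasurableSpace (U i)] [∀ i, BorelSpace (U i)]

/-- Randomised strategies are mixtures of deterministic ones, one of which does at least as well. -/
lemma exists_deterministic_expectedCost_le [∀ i, Nonempty (U i)] (T : StaticTeam N X Y U)
    (hcont : Continuous T.cost) (π : T.BehavioralProfile) :
    ∃ γ : T.DeterministicProfile, T.expectedCost γ.toBehavioral ≤ T.expectedCost π := by
  -- Each kernel is the image of the uniform law on the unit interval under a jointly measurable
  -- map, so `t i` acts as the private seed of agent `i`.
  choose f hf hfπ using fun i => (π i).1.exists_measurable_map_eq_unitInterval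
  have hsec : ∀ i t, Measurable fun y => f i y t := fun i t =>
    (hf i).comp (measurable_id.prodMk measurable_const)
  have hcm : Measurable fun p => (T.cost p : ℝ≥0∞) := hcont.measurable.coe_nnreal_ennreal
  let vol : Measure (Fin N → unitInterval) := Measure.pi fun _ => volume
  have hcu : ∀ x y, Measurable fun u => (T.cost (x, y, u) : ℝ≥0∞) := fun x y =>
    hcm.comp (measurable_const.prodMk (measurable_const.prodMk measurable_id))
  have hjoint : Measurable fun p : (X × ∀ i, Y i) × (Fin N → unitInterval) =>
      (T.cost (p.1.1, p.1.2, fun i => f i (p.1.2 i) (p.2 i)) : ℝ≥0∞) := by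
    refine hcm.comp ((measurable_fst.comp measurable_fst).prodMk
      ((measurable_snd.comp measurable_fst).prodMk (measurable_pi_lambda _ fun i => ?_)))
    exact (hf i).comp (((measurable_pi_apply i).comp (measurable_snd.comp measurable_fst)).prodMk
      ((measurable_pi_apply i).comp measurable_snd))
  have hmix : T.expectedCost π =
      ∫⁻ t, ∫⁻ ω, (T.cost (ω.1, ω.2, fun i => f i (ω.2 i) (t i)) : ℝ≥0∞) ∂T.law ∂vol := by
    rw [← lintegral_lintegral_swap hjoint.aemeasurable]
    refine lintegral_congr fun ω => ?_
    have hfi : ∀ i, Measurable (f i (ω.2 i)) := fun i =>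
      (hf i).comp (measurable_const.prodMk measurable_id)
    have : Measure.pi (fun i => (π i).1 (ω.2 i)) =
        vol.map (fun t i => f i (ω.2 i) (t i)) := by
      simp_rw [← hfπ]
      have : ∀ i, IsProbabilityMeasure ((volume : Measure unitInterval).map (f i (ω.2 i))) :=
        fun i => Measure.isProbabilityMeasure_map (hfi i).aemeasurable
      exact (Measure.pi_map_pi fun i => (hfi i).aemeasurable).symm
    have hmt : Measurable fun (t : Fin N → unitInterval) i => f i (ω.2 i) (t i) :=
      measurable_pi_lambda _ fun i => (hfi i).comp (measurable_pi_apply i)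
    rw [this, lintegral_map (hcu _ _) hmt]
  -- Some seed vector costs no more than the average.
  obtain ⟨t, ht⟩ := exists_le_lintegral (μ := vol)
    (f := fun t => ∫⁻ ω, (T.cost (ω.1, ω.2, fun i => f i (ω.2 i) (t i)) : ℝ≥0∞) ∂T.law)
    hjoint.lintegral_prod_left'.aemeasurable
  refine ⟨fun i => ⟨fun y => f i y (t i), hsec i (t i)⟩, ?_⟩
  rw [hmix]
  refine le_trans (le_of_eq (lintegral_congr fun ω => ?_)) ht
  simp only [DeterministicProfile.toBehavioral, Kernel.deterministic_apply]
  rw [pi_dirac, lintegral_dirac' _ (hcu _ _)]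

/-- The change of measure: correlation between state and observations moves into the weight `g`,
leaving a product law. -/
lemma expectedCost_eq_lintegral_independentLaw (T : StaticTeam N X Y U)
    (hcont : Continuous T.cost) (μX : ProbabilityMeasure X)
    (μ : ∀ i, ProbabilityMeasure (Y i)) {g : X × (∀ i, Y i) → ℝ≥0} (hg : Measurable g)
    (hlaw : T.law = ((μX : Measure X).prod
      (Measure.pi fun i => (μ i : Measure (Y i)))).withDensity fun p => (g p : ℝ≥0∞))
    (π : T.BehavioralProfile) (Q : ∀ i, ProbabilityMeasure (Y i × U i))
    (hQ : ∀ i, (Q i : Measure (Y i × U i)) = (μ i : Measure (Y i)) ⊗ₘ (π i).1) :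
    T.expectedCost π = ∫⁻ p, (g (forgetActions p) : ℝ≥0∞) *
      T.cost (p.1, (fun i => (p.2 i).1), fun i => (p.2 i).2)
        ∂(independentLaw μX Q : Measure (X × ∀ i, Y i × U i)) := by
  have hcm : Measurable fun p => (T.cost p : ℝ≥0∞) := hcont.measurable.coe_nnreal_ennreal
  let κ : ∀ i, Kernel (Y i) (U i) := fun i => (π i).1
  have hinner : Measurable fun ω : X × ∀ i, Y i =>
      ∫⁻ u, (T.cost (ω.1, ω.2, u) : ℝ≥0∞) ∂(piKernel κ (ω.2)) := by
    refine Measurable.lintegral_kernel_prod_right' (κ := (piKernel κ).comap Prod.snd measurable_snd)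
      (f := fun p : (X × ∀ i, Y i) × (∀ i, U i) => (T.cost (p.1.1, p.1.2, p.2) : ℝ≥0∞))
      (hcm.comp (by fun_prop))
  have hF : Measurable fun p : X × ∀ i, Y i × U i => (g (forgetActions p) : ℝ≥0∞) *
      T.cost (p.1, (fun i => (p.2 i).1), fun i => (p.2 i).2) :=
    (hg.comp measurable_forgetActions).coe_nnreal_ennreal.mul (hcm.comp (by fun_prop))
  have hind : (independentLaw μX Q : Measure (X × ∀ i, Y i × U i)) =
      (μX : Measure X).prod (Measure.pi fun i => (μ i : Measure (Y i)) ⊗ₘ κ i) := by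
    simp_rw [κ, ← hQ]; rfl
  have hJ : T.expectedCost π = ∫⁻ ω, ∫⁻ u, (T.cost (ω.1, ω.2, u) : ℝ≥0∞) ∂(piKernel κ (ω.2))
      ∂T.law := rfl
  rw [hJ, hlaw, lintegral_withDensity_eq_lintegral_mul _ hg.coe_nnreal_ennreal hinner, hind,
    lintegral_prod _ (hg.coe_nnreal_ennreal.mul hinner).aemeasurable,
    lintegral_prod _ hF.aemeasurable]
  refine lintegral_congr fun x => ?_
  refine Eq.trans ?_ (lintegral_pi_compProd _ κ
    (hF.comp (measurable_const.prodMk measurable_id) : Measurable fun z => _)).symm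
  refine lintegral_congr fun y => ?_
  simp only [Pi.mul_apply, forgetActions, Function.comp_apply, id]
  exact (lintegral_const_mul _ (hcm.comp (measurable_const.prodMk
    (measurable_const.prodMk measurable_id)))).symm

/-- A team whose law is absolutely continuous with respect to a product law has an optimal
solution in deterministic strategies. -/
theorem exists_isOptimal_of_absolutelyContinuous [∀ i, CompactSpace (U i)] [∀ i, Nonempty (U i)]
    (T : StaticTeam N X Y U) (hcont : Continuous T.cost) (μX : Measure X)
    [IsProbabilityMeasure μX] (μ : ∀ i, Measure (Y i)) [∀ i, IsProbabilityMeasure (μ i)]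
    (hlaw : T.law ≪ μX.prod (Measure.pi μ)) :
    ∃ γ : T.DeterministicProfile, T.IsOptimal γ.toBehavioral := by
  let μX' : ProbabilityMeasure X := ⟨μX, inferInstance⟩
  let μ' : ∀ i, ProbabilityMeasure (Y i) := fun i => ⟨μ i, inferInstance⟩
  let g : X × (∀ i, Y i) → ℝ≥0 := fun p => (T.law.rnDeriv (μX.prod (Measure.pi μ)) p).toNNReal
  have hgm : Measurable g := (Measure.measurable_rnDeriv _ _).ennreal_toNNReal
  have hgi : Integrable (fun x => (g x : ℝ)) (μX.prod (Measure.pi μ)) :=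
    Measure.integrable_toReal_rnDeriv
  have hd : T.law = (μX.prod (Measure.pi μ)).withDensity fun p => (g p : ℝ≥0∞) := by
    conv_lhs => rw [← Measure.withDensity_rnDeriv_eq _ _ hlaw]
    refine withDensity_congr_ae ?_
    filter_upwards [Measure.rnDeriv_lt_top T.law (μX.prod (Measure.pi μ))] with p hp
    exact (ENNReal.coe_toNNReal hp.ne).symm
  obtain ⟨Q, hQ, hmin⟩ := exists_isMinOn_lintegral_independentLaw (U := U) μX' μ' hgi hgm
    (c := fun p => T.cost (p.1, (fun i => (p.2 i).1), fun i => (p.2 i).2))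
    (hcont.comp (by fun_prop))
  -- Disintegrating the minimizer along the observations turns it back into a profile.
  let π : T.BehavioralProfile := fun i => ⟨(Q i : Measure (Y i × U i)).condKernel, inferInstance⟩
  have hQπ : ∀ i, (Q i : Measure (Y i × U i)) = (μ' i : Measure (Y i)) ⊗ₘ (π i).1 := fun i => by
    rw [← show (Q i).map measurable_fst.aemeasurable = μ' i from hQ i trivial]
    exact ((Q i : Measure (Y i × U i)).disintegrate _).symm
  obtain ⟨γ, hγ⟩ := T.exists_deterministic_expectedCost_le hcont π
  refine ⟨γ, le_antisymm (le_iInf fun π' => hγ.trans ?_) (iInf_le _ _)⟩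
  let Q' : ∀ i, ProbabilityMeasure (Y i × U i) := fun i => ⟨μ i ⊗ₘ (π' i).1, inferInstance⟩
  have hQ' : Q' ∈ Set.univ.pi fun i => jointLaws (U i) (μ' i) := fun i _ =>
    Subtype.ext (Measure.fst_compProd (μ i) (π' i).1)
  rw [T.expectedCost_eq_lintegral_independentLaw hcont μX' μ' hgm hd π Q hQπ,
    T.expectedCost_eq_lintegral_independentLaw hcont μX' μ' hgm hd π' Q' fun i => rfl]
  exact hmin hQ'

end Existence

end StaticTeam

/-! ### Domination of conditional laws by a fixed probability measure -/

lemma ConditionC1.sigmaFinite {A Y : Type*} [MetricSpace A] [MeasurableSpace A] [Nonempty A]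
    [TopologicalSpace Y] [MeasurableSpace Y] {η : A × Y → ℝ} {ν : Measure Y}
    (h : ConditionC1 η ν) : SigmaFinite ν := by
  obtain ⟨-, h, hm, -, -, hint, hvar⟩ := h
  let a : A := Classical.arbitrary A
  -- Taking both points equal to `a` in the strict inequality gives positivity. Thus `h (a, ·) ν` is
  -- a finite measure, and the finite density `1 / h (a, ·)` recovers `ν` from it.
  have hpos : ∀ y, 0 < h (a, y) := fun y => by
    obtain ⟨δ, hδ, H⟩ := hvar 1 one_pos
    simpa using H a a (by simpa using hδ) y
  have hma : Measurable fun y => ENNReal.ofReal (h (a, y)) :=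
    (hm.comp (measurable_const.prodMk measurable_id)).ennreal_ofReal
  have hfin : IsFiniteMeasure (ν.withDensity fun y => ENNReal.ofReal (h (a, y))) :=
    isFiniteMeasure_withDensity
      ((le_iSup (fun a => ∫⁻ y, ENNReal.ofReal (h (a, y)) ∂ν) a).trans_lt hint).ne
  have hinv := withDensity_inv_same (μ := ν) hma
    (Filter.Eventually.of_forall fun y => (ENNReal.ofReal_pos.2 (hpos y)).ne')
    (Filter.Eventually.of_forall fun y => ENNReal.ofReal_ne_top)
  rw [← hinv]
  exact SigmaFinite.withDensity_of_ne_top (Filter.Eventually.of_forall fun y =>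
    ENNReal.inv_ne_top.2 (ENNReal.ofReal_pos.2 (hpos y)).ne')

section CondDensity

variable {Ω A B : Type*} [MeasurableSpace Ω] [MeasurableSpace A] [MeasurableSpace B]
  [StandardBorelSpace B] [Nonempty B] {P : Measure Ω} [IsProbabilityMeasure P]
  {f : Ω → A} {g : Ω → B} {φ : A × B → ℝ} {ν : Measure B}

lemma HasCondDensity.ae_absolutelyContinuous (h : HasCondDensity P f g φ ν) :
    ∀ᵐ a ∂P.map f, condDistrib g f P a ≪ ν := by
  filter_upwards [h] with a ha
  rw [ha]
  exact withDensity_absolutelyContinuous _ _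

lemma HasCondDensity.exists_isProbabilityMeasure [SFinite ν] (hf : Measurable f)
    (h : HasCondDensity P f g φ ν) :
    ∃ μ : Measure B, IsProbabilityMeasure μ ∧
      ∀ᵐ a ∂P.map f, condDistrib g f P a ≪ μ := by
  have hP : IsProbabilityMeasure (P.map f) := Measure.isProbabilityMeasure_map hf.aemeasurable
  obtain ⟨a, ha⟩ := h.ae_absolutelyContinuous.exists
  -- A probability measure dominated by `ν` rules out `ν = 0`, so `ν.toFinite` is a probability
  -- measure.
  have : NeZero ν := ⟨fun h0 => by
    rw [h0, Measure.absolutelyContinuous_zero_iff] at ha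
    exact IsProbabilityMeasure.ne_zero _ ha⟩
  have hν : ν ≪ ν.toFinite := absolutelyContinuous_toFinite ν
  exact ⟨ν.toFinite, inferInstance, h.ae_absolutelyContinuous.mono fun a ha => ha.trans hν⟩

/-- If almost every conditional law is absolutely continuous with respect to `μ`, then the joint
law is absolutely continuous with respect to a product measure. -/
lemma map_prodMk_absolutelyContinuous (hg : Measurable g) {μ : Measure B}
    [SFinite μ] (h : ∀ᵐ a ∂P.map f, condDistrib g f P a ≪ μ) :
    P.map (fun ω => (f ω, g ω)) ≪ (P.map f).prod μ := by
  rw [← compProd_map_condDistrib hg.aemeasurable, ← Measure.compProd_const]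
  exact Measure.AbsolutelyContinuous.compProd_right (h.mono fun a ha => by simpa using ha)

end CondDensity

/-! ### Absolute continuity of the joint law -/

namespace StaticTeam

section Measurability

variable {N : ℕ} {X : Type*} {Y U : Fin N → Type*}
  [MeasurableSpace X] [∀ i, MeasurableSpace (Y i)]

lemma measurable_state : Measurable (state (X := X) (Y := Y)) := measurable_fst

lemma measurable_allObs : Measurable (allObs (X := X) (Y := Y)) := measurable_snd

lemma measurable_obs (i : Fin N) : Measurable (obs (X := X) (Y := Y) i) :=
  (measurable_pi_apply i).comp measurable_snd

lemma HasFiniteCostProfile.nonempty_action [∀ i, MeasurableSpace (U i)] [∀ i, Nonempty (Y i)]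
    {T : StaticTeam N X Y U} (h : T.HasFiniteCostProfile) (i : Fin N) :
    Nonempty (U i) := by
  obtain ⟨π, -⟩ := h
  exact ((π i).1 (Classical.arbitrary (Y i))).nonempty_of_neZero

end Measurability

section AbsoluteContinuity

variable {N : ℕ} {X : Type*} {Y U : Fin N → Type*}
  [MetricSpace X] [CompleteSpace X] [SecondCountableTopology X]
  [MeasurableSpace X] [BorelSpace X] [Nonempty X]
  [∀ i, MetricSpace (Y i)] [∀ i, CompleteSpace (Y i)] [∀ i, SecondCountableTopology (Y i)]
  [∀ i, MeasurableSpace (Y i)] [∀ i, BorelSpace (Y i)] [∀ i, Nonempty (Y i)]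
  [∀ i, TopologicalSpace (U i)]

/-- Given the state, the observation law is a product whose factors are dominated by measures `μ i`
independent of the state. -/
lemma CondIndepObs.exists_absolutelyContinuous {T : StaticTeam N X Y U} (h : T.CondIndepObs) :
    ∃ (μX : Measure X) (μ : ∀ i, Measure (Y i)), IsProbabilityMeasure μX ∧
      (∀ i, IsProbabilityMeasure (μ i)) ∧ T.law ≪ μX.prod (Measure.pi μ) := by
  obtain ⟨-, -, -, νX, νY, η, ρ, -, -, hind, hη, -, -, hC⟩ := h
  have hs : ∀ i, SigmaFinite (νY i) := fun i => (hC i).sigmaFinite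
  choose μ hμ hac using fun i => (hη i).exists_isProbabilityMeasure measurable_state
  refine ⟨T.law.map state, μ, Measure.isProbabilityMeasure_map measurable_state.aemeasurable, hμ, ?_⟩
  have hall : ∀ᵐ x ∂T.law.map state, condDistrib allObs state T.law x ≪ Measure.pi μ := by
    filter_upwards [hind, ae_all_iff.2 hac] with x hx hacx
    rw [hx]
    exact pi_absolutelyContinuous hacx
  have := map_prodMk_absolutelyContinuous measurable_allObs hall
  rwa [show (fun ω : X × ∀ i, Y i => (state ω, allObs ω)) = id from rfl, Measure.map_id] at this

/-- The law factors as the law of `(x, y₁)` followed by that of `y₂` given `y₁`. The density `ρ₁`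
dominates the first by a product and `η₂` dominates the second. -/
lemma DegradedObs.exists_absolutelyContinuous {T : StaticTeam N X Y U} (h : T.DegradedObs) :
    ∃ (μX : Measure X) (μ : ∀ i, Measure (Y i)), IsProbabilityMeasure μX ∧
      (∀ i, IsProbabilityMeasure (μ i)) ∧ T.law ≪ μX.prod (Measure.pi μ) := by
  obtain ⟨-, -, -, i₁, i₂, hne, htwo, νX, ν₁, ν₂, η₁, η₂, ρ₁, ρ₂, -, -, -, -, hdeg, hη₂, -, -, hρ₁,
    hC₁, -, -, hC₂⟩ := h
  have := hC₁.sigmaFinite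
  have := hC₂.sigmaFinite
  obtain ⟨μX, hμX, hacX⟩ := hρ₁.exists_isProbabilityMeasure (measurable_obs i₁)
  obtain ⟨μ₂, hμ₂, hac₂⟩ := hη₂.exists_isProbabilityMeasure (measurable_obs i₁)
  have hPX : IsProbabilityMeasure (T.law.map (state (X := X) (Y := Y))) :=
    Measure.isProbabilityMeasure_map measurable_state.aemeasurable
  have hP₁ : IsProbabilityMeasure (T.law.map (obs (X := X) (Y := Y) i₁)) :=
    Measure.isProbabilityMeasure_map (measurable_obs i₁).aemeasurable
  have hPj : IsProbabilityMeasure (T.law.map (fun ω : X × ∀ i, Y i => (state ω, obs i₁ ω))) :=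
    Measure.isProbabilityMeasure_map (measurable_state.prodMk (measurable_obs i₁)).aemeasurable
  have hpair : T.law.map (fun ω => (state ω, obs i₁ ω)) ≪ μX.prod (T.law.map (obs i₁)) := by
    have := (map_prodMk_absolutelyContinuous measurable_state hacX).map measurable_swap
    rwa [Measure.map_map measurable_swap ((measurable_obs i₁).prodMk measurable_state),
      Measure.prod_swap] at this
  have htriple : T.law.map (fun ω => (state ω, (obs i₁ ω, obs i₂ ω))) ≪
      μX.prod ((T.law.map (obs i₁)).prod μ₂) := by
    have hm₁₂ : Measurable fun ω : X × ∀ i, Y i => (obs i₁ ω, obs i₂ ω) :=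
      (measurable_obs i₁).prodMk (measurable_obs i₂)
    refine Measure.AbsolutelyContinuous.mk fun s hs hs0 => ?_
    let K := condDistrib (obs (X := X) i₂) (obs i₁) T.law
    have hmK : Measurable fun p : X × Y i₁ => K p.2 {b | (p.1, (p.2, b)) ∈ s} :=
      Kernel.measurable_kernel_prodMk_left (κ := K.comap Prod.snd measurable_snd)
        (t := {q : (X × Y i₁) × Y i₂ | (q.1.1, (q.1.2, q.2)) ∈ s})
        (hs.preimage (by fun_prop))
    -- Degradedness enters here: the kernel producing `y₂` sees only `y₁`, not the state.
    have hlaw : T.law.map (fun ω => (state ω, (obs i₁ ω, obs i₂ ω))) s =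
        ∫⁻ p, K p.2 {b | (p.1, (p.2, b)) ∈ s} ∂T.law.map (fun ω => (state ω, obs i₁ ω)) := by
      rw [← compProd_map_condDistrib hm₁₂.aemeasurable, Measure.compProd_apply hs,
        ← compProd_map_condDistrib (measurable_obs i₁).aemeasurable,
        Measure.lintegral_compProd hmK]
      refine lintegral_congr_ae ?_
      filter_upwards [hdeg] with x hx
      rw [hx, Measure.compProd_apply (measurable_prodMk_left hs)]
      rfl
    rw [hlaw, lintegral_eq_zero_iff hmK]
    have h₂ : ∀ᵐ p ∂T.law.map (fun ω : X × ∀ i, Y i => (state ω, obs i₁ ω)), K p.2 ≪ μ₂ := by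
      refine ae_of_ae_map measurable_snd.aemeasurable (p := fun y => K y ≪ μ₂) ?_
      rwa [Measure.map_map measurable_snd (measurable_state.prodMk (measurable_obs i₁))]
    have h₀ : ∀ᵐ p ∂μX.prod (T.law.map (obs i₁)), μ₂ {b | (p.1, (p.2, b)) ∈ s} = 0 := by
      have hmp := measurePreserving_prodAssoc μX (T.law.map (obs (X := X) i₁)) μ₂
      rw [← hmp.measure_preimage hs.nullMeasurableSet] at hs0
      have hae : ∀ᵐ q ∂(μX.prod (T.law.map (obs (X := X) i₁))).prod μ₂,
          (q.1.1, (q.1.2, q.2)) ∉ s := measure_eq_zero_iff_ae_notMem.1 hs0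
      filter_upwards [Measure.ae_ae_of_ae_prod hae] with p hp
      exact measure_eq_zero_iff_ae_notMem.2 hp
    filter_upwards [h₂, hpair.ae_le h₀] with p hp₂ hp₀
    exact hp₂ hp₀
  classical
  -- The default `y₀` is immaterial: both coordinates are overwritten, so `ψ` identifies pairs with
  -- observation vectors.
  let y₀ : ∀ i, Y i := fun i => Classical.arbitrary (Y i)
  let ψ : Y i₁ × Y i₂ → ∀ i, Y i := fun p => Function.update (Function.update y₀ i₁ p.1) i₂ p.2
  have hψ₁ : ∀ p, ψ p i₁ = p.1 := fun p => by simp [ψ, hne]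
  have hψ₂ : ∀ p, ψ p i₂ = p.2 := fun p => by simp [ψ]
  have hψ : Measurable ψ := measurable_pi_lambda _ fun j => by
    rcases htwo j with rfl | rfl
    · simp_rw [hψ₁]; exact measurable_fst
    · simp_rw [hψ₂]; exact measurable_snd
  let μ : ∀ i, Measure (Y i) := Function.update (fun i => T.law.map (obs i)) i₂ μ₂
  have hμ₁ : μ i₁ = T.law.map (obs i₁) := by simp [μ, hne]
  have hμ₂' : μ i₂ = μ₂ := by simp [μ]
  have hμ : ∀ i, IsProbabilityMeasure (μ i) := fun j => by
    rcases htwo j with rfl | rfl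
    · rwa [hμ₁]
    · rwa [hμ₂']
  refine ⟨μX, μ, hμX, hμ, ?_⟩
  have huniv : (Finset.univ : Finset (Fin N)) = {i₁, i₂} := by
    ext j; simpa using htwo j
  have hpi : ((T.law.map (obs i₁)).prod μ₂).map ψ = Measure.pi μ := by
    refine (Measure.pi_eq fun s hs => ?_).symm
    rw [Measure.map_apply hψ (MeasurableSet.univ_pi hs), huniv, Finset.prod_pair hne, hμ₁, hμ₂',
      ← Measure.prod_prod]
    congr 1
    ext p
    simp only [Set.mem_preimage, Set.mem_univ_pi, Set.mem_prod]
    refine ⟨fun H => ⟨hψ₁ p ▸ H i₁, hψ₂ p ▸ H i₂⟩, fun H j => ?_⟩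
    rcases htwo j with rfl | rfl
    · rw [hψ₁]; exact H.1
    · rw [hψ₂]; exact H.2
  have hmΨ : Measurable (Prod.map (id : X → X) ψ) := measurable_id.prodMap hψ
  have key := htriple.map hmΨ
  rw [Measure.map_map hmΨ (measurable_state.prodMk
      ((measurable_obs i₁).prodMk (measurable_obs i₂))),
    ← Measure.map_prod_map _ _ measurable_id hψ, Measure.map_id, hpi] at key
  have hid : Prod.map (id : X → X) ψ ∘ (fun ω => (state ω, (obs i₁ ω, obs i₂ ω))) = id := by
    funext ω
    refine Prod.ext rfl (funext fun j => ?_)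
    rcases htwo j with rfl | rfl
    · exact hψ₁ _
    · exact hψ₂ _
  rwa [hid, Measure.map_id] at key

end AbsoluteContinuity

end StaticTeam

end

theorem mainTheorem10 {N : ℕ} {X : Type*} {Y U : Fin N → Type*}
    [MetricSpace X] [CompleteSpace X] [SecondCountableTopology X]
    [MeasurableSpace X] [BorelSpace X] [Nonempty X]
    [∀ i, MetricSpace (Y i)] [∀ i, CompleteSpace (Y i)] [∀ i, SecondCountableTopology (Y i)]
    [∀ i, MeasurableSpace (Y i)] [∀ i, BorelSpace (Y i)] [∀ i, Nonempty (Y i)]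
    [∀ i, TopologicalSpace (U i)] [∀ i, PolishSpace (U i)] [∀ i, CompactSpace (U i)]
    [∀ i, MeasurableSpace (U i)] [∀ i, BorelSpace (U i)]
    (T : StaticTeam N X Y U)
    (hcont : Continuous T.cost)
    (hfin : T.HasFiniteCostProfile)
    (hobs : T.CondIndepObs ∨ T.DegradedObs) :
    ∃ γ : T.DeterministicProfile, T.IsOptimal γ.toBehavioral := by
  have hU : ∀ i, Nonempty (U i) := hfin.nonempty_action
  obtain ⟨μX, μ, hμX, hμ, hlaw⟩ : ∃ (μX : Measure X) (μ : ∀ i, Measure (Y i)),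
      IsProbabilityMeasure μX ∧ (∀ i, IsProbabilityMeasure (μ i)) ∧
      T.law ≪ μX.prod (Measure.pi μ) :=
    hobs.elim (fun h => h.exists_absolutelyContinuous) fun h => h.exists_absolutelyContinuous
  exact StaticTeam.exists_isOptimal_of_absolutelyContinuous T hcont μX μ hlaw
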